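/- Let $\bar P=\prod_{x\in\mathbb Z}\bar P_x$ be a product of Borel probability measures $\bar P_x$ on $\mathbb R$, regarded as a measure on $\Omega=\mathbb R^{\mathbb Z}$, with expectation $\bar E$. For $\omega=(\omega_x)_{x\in\mathbb Z}\in\Omega$ and $x\in\mathbb Z$ let $$U_x=\frac1{\sqrt2}\begin{pmatrix}e^{i\omega_x}&1\\1&-e^{-i\omega_x}\end{pmatrix}=P_x+Q_x,$$ where $P_x$ has the first row of $U_x$ and zero second row, and $Q_x$ has zero first row and the second row of $U_x$. For $n=l+m$ let $\Xi_n(l,m)$ be the sum, over all nearest-neighbour paths of length $n$ from the origin with $l$ steps to the left and $m$ steps to the right, of the products (later steps to the left) of the matrices $P_y$ for each left step and $Q_y$ for each right step made from the site $y$. With $\varphi_*={}^T[1/\sqrt2,\,i/\sqrt2]$, let $P_n^\omega$ be the probability measure on $\mathbb Z$ given by $P_n^\omega(X_n=m-l)=\|\Xi_n(l,m)\varphi_*\|^2$ for $l+m=n$ (and no mass elsewhere), and let $\mathbb P_n=\bar P\otimes P_n^\omega$ be the measure on $\Omega\times\mathbb Z$ with $\mathbb P_n(H\times\{X_n\in A\})=\int_H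 P_n^\omega(X_n\in A)\,\bar P(d\omega)$. Let $$f_K(x)=\frac{1}{\pi(1-x^2)\sqrt{1-2x^2}}\,I_{(-1/\sqrt2,\,1/\sqrt2)}(x).$$ Then $x\mapsto\{1-\bar E[\sin\omega_0]\,x\}f_K(x)$ is a probability density on $\mathbb R$, and under $\mathbb P_n$ the variables $X_n/n$ converge weakly to the law with this density; moreover, for all real $u\le v$, $$\lim_{n\to\infty}\mathbb P_n\Bigl(u\le\frac{X_n}{n}\le v\Bigr)=\int_u^v\{1-\bar E[\sin\omega_0]\,x\}\,f_K(x)\,dx.$$ In particular, if $\bar P_0$ (the law of $\omega_0$) is symmetric, i.e. invariant under $t\mapsto -t$, then $X_n/n$ converges weakly under $\mathbb P_n$ to the law with density $f_K$, and for all real $u\le v$, $$\lim_{n\to\infty}\mathbb P_n\Bigl(u\le\frac{X_n}{n}\le v\Bigr)=\int_u^v f_K(x)\,dx.$$ -/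

import Mathlib

open MeasureTheory ProbabilityTheory Filter
open scoped Topology Matrix BoundedContinuousFunction

namespace QWRE

noncomputable section

/-- The space of environments `Ω = ℝ^ℤ`, with the product (equivalently Borel) sigma-field. -/
abbrev Env : Type := ℤ → ℝ

/-- The local coin `U_y = (1/√2) [[e^{i ω_y}, 1], [1, -e^{-i ω_y}]]` at the site `y`.
The index `0` is the left chirality `|L⟩`, the index `1` is the right chirality `|R⟩`. -/
def coin (ω : Env) (y : ℤ) : Matrix (Fin 2) (Fin 2) ℂ :=
  ((1 / √2 : ℝ) : ℂ) •
    !![Complex.exp (Complex.I * (ω y : ℂ)), 1; 1, -Complex.exp (-(Complex.I * (ω y : ℂ)))]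

/-- `P_y`: the first row of `U_y` (the walker at `y` moves one step to the left). -/
def stepL (ω : Env) (y : ℤ) : Matrix (Fin 2) (Fin 2) ℂ :=
  !![coin ω y 0 0, coin ω y 0 1; 0, 0]

/-- `Q_y`: the second row of `U_y` (the walker at `y` moves one step to the right). -/
def stepR (ω : Env) (y : ℤ) : Matrix (Fin 2) (Fin 2) ℂ :=
  !![0, 0; coin ω y 1 0, coin ω y 1 1]

/-- The matrix of a step from `y` in direction `d` (`0` = left, `1` = right). -/
def step (ω : Env) (y : ℤ) (d : Fin 2) : Matrix (Fin 2) (Fin 2) ℂ :=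
  if d = 0 then stepL ω y else stepR ω y

/-- The number of steps in direction `d` of a path of length `n`. -/
def numSteps {n : ℕ} (s : Fin n → Fin 2) (d : Fin 2) : ℕ :=
  (Finset.univ.filter fun j => s j = d).card

/-- The end point of a path that starts at the origin. -/
def endpoint {n : ℕ} (s : Fin n → Fin 2) : ℤ :=
  (numSteps s 1 : ℤ) - (numSteps s 0 : ℤ)

/-- The ordered product of the step matrices along a path from the origin; later steps stand to
the left, and each step matrix is the one at the site from which the step is made. -/
def pathWeight (ω : Env) : (n : ℕ) → (Fin n → Fin 2) → Matrix (Fin 2) (Fin 2) ℂ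
  | 0, _ => 1
  | n + 1, s =>
      step ω (endpoint (Fin.init s)) (s (Fin.last n)) * pathWeight ω n (Fin.init s)

/-- `Ξ_n(l, m)`: the sum of the weights of all paths of length `n` from the origin with
`l` steps to the left and `m` steps to the right. -/
def Xi (ω : Env) (n l m : ℕ) : Matrix (Fin 2) (Fin 2) ℂ :=
  ∑ s ∈ Finset.univ.filter (fun s : Fin n → Fin 2 => numSteps s 0 = l ∧ numSteps s 1 = m),
    pathWeight ω n s

/-- The initial qubit state `φ_* = ᵀ[1/√2, i/√2]`. -/
def initState : Fin 2 → ℂ :=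
  ![((1 / √2 : ℝ) : ℂ), Complex.I * ((1 / √2 : ℝ) : ℂ)]

/-- `‖Ξ_n(l, m) φ_*‖²` (Euclidean norm on `ℂ²`): the probability that the walker in the
environment `ω` is at the position `m - l` at time `n = l + m`. -/
def prob (ω : Env) (n l m : ℕ) : ℝ :=
  ‖WithLp.toLp 2 (Xi ω n l m *ᵥ initState)‖ ^ 2

/-! ### Helper facts: measurability in the environment and total mass one -/

theorem continuous_coin (y : ℤ) (i j : Fin 2) : Continuous fun ω : Env => coin ω y i j := by
  fin_cases i <;> fin_cases j <;> simp [coin] <;> fun_prop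

theorem continuous_step (y : ℤ) (d : Fin 2) : Continuous fun ω : Env => step ω y d := by
  refine continuous_matrix fun i j => ?_
  have h := continuous_coin y
  fin_cases d <;> fin_cases i <;> fin_cases j <;> simp [step, stepL, stepR, h] <;>
    exact continuous_const

theorem continuous_pathWeight (n : ℕ) (s : Fin n → Fin 2) :
    Continuous fun ω : Env => pathWeight ω n s := by
  induction n with
  | zero => exact continuous_const
  | succ n ih => exact (continuous_step _ _).matrix_mul (ih _)

theorem measurable_prob (n l m : ℕ) : Measurable fun ω : Env => prob ω n l m := by
  have h : Continuous fun ω : Env => Xi ω n l m :=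
    continuous_finsetSum _ fun s _ => continuous_pathWeight n s
  have h2 : Continuous fun ω : Env => Xi ω n l m *ᵥ initState :=
    h.matrix_mulVec continuous_const
  have h3 : Continuous fun ω : Env => prob ω n l m :=
    ((PiLp.continuous_toLp 2 _).comp h2).norm.pow 2
  exact h3.measurable

theorem numSteps_snoc {n : ℕ} (s : Fin n → Fin 2) (d e : Fin 2) :
    numSteps (Fin.snoc (α := fun _ => Fin 2) s d) e = numSteps s e + if d = e then 1 else 0 := by
  simp only [numSteps, Finset.card_filter, Fin.sum_univ_castSucc, Fin.snoc_castSucc,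
    Fin.snoc_last]

theorem Xi_zero (ω : Env) : Xi ω 0 0 0 = 1 := by
  simp [Xi, numSteps, pathWeight]

theorem Xi_succ (ω : Env) (n l m : ℕ) :
    Xi ω (n + 1) l m =
      (∑ s ∈ Finset.univ.filter (fun s : Fin n → Fin 2 => numSteps s 0 + 1 = l ∧ numSteps s 1 = m),
        stepL ω (endpoint s) * pathWeight ω n s) +
      ∑ s ∈ Finset.univ.filter (fun s : Fin n → Fin 2 => numSteps s 0 = l ∧ numSteps s 1 + 1 = m),
        stepR ω (endpoint s) * pathWeight ω n s := by
  simp only [Xi, Finset.sum_filter]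
  rw [← (Fin.snocEquiv (fun _ : Fin (n + 1) => Fin 2)).sum_comp, Fintype.sum_prod_type,
    Fin.sum_univ_two]
  simp [Fin.snocEquiv, numSteps_snoc, pathWeight, step]

/-- The one-step recursion
`Ξ_{n+1}(l, m) = P_{x+1} Ξ_n(l-1, m) + Q_{x-1} Ξ_n(l, m-1)` with `x = m - l`, interior case. -/
theorem Xi_succ_succ_succ (ω : Env) (n l m : ℕ) :
    Xi ω (n + 1) (l + 1) (m + 1) =
      stepL ω ((m + 1 : ℕ) - (l : ℕ) : ℤ) * Xi ω n l (m + 1) +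
      stepR ω ((m : ℕ) - (l + 1 : ℕ) : ℤ) * Xi ω n (l + 1) m := by
  rw [Xi_succ]
  simp only [Xi, Finset.mul_sum, Nat.add_right_cancel_iff]
  refine congrArg₂ (fun a b => a + b) ?_ ?_
  all_goals
    refine Finset.sum_congr rfl fun s hs => ?_
    simp only [Finset.mem_filter] at hs
    simp only [endpoint, hs.2.1, hs.2.2]

theorem Xi_succ_left (ω : Env) (n l : ℕ) :
    Xi ω (n + 1) (l + 1) 0 = stepL ω ((0 : ℕ) - (l : ℕ) : ℤ) * Xi ω n l 0 := by
  rw [Xi_succ]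
  simp only [Xi, Finset.mul_sum, Nat.add_right_cancel_iff]
  simp only [Nat.add_eq_zero_iff, one_ne_zero, and_false, Finset.filter_false,
    Finset.sum_empty, add_zero]
  refine Finset.sum_congr rfl fun s hs => ?_
  simp only [Finset.mem_filter] at hs
  simp only [endpoint, hs.2.1, hs.2.2]

theorem Xi_succ_right (ω : Env) (n m : ℕ) :
    Xi ω (n + 1) 0 (m + 1) = stepR ω ((m : ℕ) - (0 : ℕ) : ℤ) * Xi ω n 0 m := by
  rw [Xi_succ]
  simp only [Xi, Finset.mul_sum, Nat.add_right_cancel_iff]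
  simp only [Nat.add_eq_zero_iff, one_ne_zero, and_false, false_and, Finset.filter_false,
    Finset.sum_empty, zero_add]
  refine Finset.sum_congr rfl fun s hs => ?_
  simp only [Finset.mem_filter] at hs
  simp only [endpoint, hs.2.1, hs.2.2]

/-- The squared norm on `ℂ²`, in coordinates. -/
theorem norm_sq_toLp (v : Fin 2 → ℂ) :
    ‖WithLp.toLp 2 v‖ ^ 2 = Complex.normSq (v 0) + Complex.normSq (v 1) := by
  simp [EuclideanSpace.norm_sq_eq, Fin.sum_univ_two, Complex.normSq_eq_norm_sq]

theorem norm_sq_step (ω : Env) (y z : ℤ) (v w : Fin 2 → ℂ) :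
    ‖WithLp.toLp 2 (stepL ω y *ᵥ v + stepR ω z *ᵥ w)‖ ^ 2 =
      ‖WithLp.toLp 2 (stepL ω y *ᵥ v)‖ ^ 2 + ‖WithLp.toLp 2 (stepR ω z *ᵥ w)‖ ^ 2 := by
  simp [norm_sq_toLp, stepL, stepR, dotProduct, Fin.sum_univ_two]

theorem norm_sq_stepL_add_stepR (ω : Env) (y : ℤ) (v : Fin 2 → ℂ) :
    ‖WithLp.toLp 2 (stepL ω y *ᵥ v)‖ ^ 2 + ‖WithLp.toLp 2 (stepR ω y *ᵥ v)‖ ^ 2 =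
      ‖WithLp.toLp 2 v‖ ^ 2 := by
  obtain ⟨r, hr⟩ : ∃ r : ℝ, r = 1 / √2 := ⟨_, rfl⟩
  have h2 : r ^ 2 = 1 / 2 := by
    rw [hr, div_pow, one_pow, Real.sq_sqrt (by norm_num)]
  have hcs := Real.sin_sq_add_cos_sq (ω y)
  have e1 : Complex.exp (Complex.I * (ω y : ℂ)) = ⟨Real.cos (ω y), Real.sin (ω y)⟩ := by
    rw [mul_comm]
    apply Complex.ext
    · simp [Complex.exp_ofReal_mul_I_re]
    · simp [Complex.exp_ofReal_mul_I_im]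
  have e2 : Complex.exp (-(Complex.I * (ω y : ℂ))) = ⟨Real.cos (ω y), -Real.sin (ω y)⟩ := by
    have : -(Complex.I * (ω y : ℂ)) = ((-ω y : ℝ) : ℂ) * Complex.I := by push_cast; ring
    rw [this]
    apply Complex.ext
    · rw [Complex.exp_ofReal_mul_I_re]; simp
    · rw [Complex.exp_ofReal_mul_I_im]; simp
  simp only [norm_sq_toLp, stepL, stepR, coin, e1, e2, Matrix.mulVec, dotProduct,
    Fin.sum_univ_two, ← hr]
  simp [Complex.normSq_apply]
  generalize Real.cos (ω y) = c at *
  generalize Real.sin (ω y) = t at *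
  have hc : c ^ 2 = 1 - t ^ 2 := by linarith
  ring_nf
  simp only [h2, hc]
  ring

/-- The position distribution at any time has total mass one. -/
theorem sum_prob (ω : Env) (n : ℕ) :
    ∑ p ∈ Finset.HasAntidiagonal.antidiagonal n, prob ω n p.1 p.2 = 1 := by
  induction n with
  | zero =>
    simp [prob, Xi_zero, norm_sq_toLp, initState, Complex.normSq_apply]
    have h2 : √2 * √2 = (2 : ℝ) := Real.mul_self_sqrt (by norm_num)
    linarith
  | succ n ih =>
    let v : ℕ → ℕ → Fin 2 → ℂ := fun l m => Xi ω n l m *ᵥ initState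
    let F : ℕ × ℕ → ℝ := fun p => match p with
      | (0, _) => 0
      | (l + 1, m) => ‖WithLp.toLp 2 (stepL ω ((m : ℤ) - (l : ℤ)) *ᵥ v l m)‖ ^ 2
    let G : ℕ × ℕ → ℝ := fun p => match p with
      | (_, 0) => 0
      | (l, m + 1) => ‖WithLp.toLp 2 (stepR ω ((m : ℤ) - (l : ℤ)) *ᵥ v l m)‖ ^ 2
    have key : ∀ p ∈ Finset.HasAntidiagonal.antidiagonal (n + 1),
        prob ω (n + 1) p.1 p.2 = F p + G p := by
      rintro ⟨l, m⟩ hp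
      rw [Finset.HasAntidiagonal.mem_antidiagonal] at hp
      rcases l with _ | l <;> rcases m with _ | m
      · simp at hp
      · simp only [prob, Xi_succ_right, ← Matrix.mulVec_mulVec, F, G, v, zero_add]
      · simp only [prob, Xi_succ_left, ← Matrix.mulVec_mulVec, F, G, v, add_zero]
      · simp only [prob, Xi_succ_succ_succ, Matrix.add_mulVec, ← Matrix.mulVec_mulVec,
          norm_sq_step, F, G, v]
    rw [Finset.sum_congr rfl key, Finset.sum_add_distrib, Finset.Nat.sum_antidiagonal_succ,
      Finset.Nat.sum_antidiagonal_succ', ← ih]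
    simp only [F, G, zero_add]
    rw [← Finset.sum_add_distrib]
    exact Finset.sum_congr rfl fun p _ => norm_sq_stepL_add_stepR ω _ _

/-- The quenched law `P_n^ω` of the position `X_n` on `ℤ`, as a kernel from environments:
`P_n^ω (X_n = m - l) = ‖Ξ_n(l, m) φ_*‖²` for `l + m = n`, and no mass elsewhere. -/
def quenched (n : ℕ) : Kernel Env ℤ where
  toFun ω := ∑ p ∈ Finset.HasAntidiagonal.antidiagonal n,
    ENNReal.ofReal (prob ω n p.1 p.2) • Measure.dirac ((p.2 : ℤ) - (p.1 : ℤ))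
  measurable' := by
    refine Measure.measurable_of_measurable_coe _ fun A _ => ?_
    simp only [Measure.coe_finsetSum, Finset.sum_apply, Measure.smul_apply, smul_eq_mul]
    exact Finset.measurable_sum _ fun p _ =>
      (measurable_prob n p.1 p.2).ennreal_ofReal.mul_const _

instance (n : ℕ) : IsMarkovKernel (quenched n) where
  isProbabilityMeasure ω := by
    constructor
    change (∑ p ∈ Finset.HasAntidiagonal.antidiagonal n,
      ENNReal.ofReal (prob ω n p.1 p.2) • Measure.dirac ((p.2 : ℤ) - (p.1 : ℤ))) Set.univ = 1
    simp only [Measure.coe_finsetSum, Finset.sum_apply, Measure.smul_apply, smul_eq_mul,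
      measure_univ, mul_one]
    rw [← ENNReal.ofReal_sum_of_nonneg fun p _ => by unfold prob; positivity, sum_prob,
      ENNReal.ofReal_one]

/-- The law `P̄ = ∏_x P̄_x` of the random environment. -/
def envLaw (μ : ℤ → Measure ℝ) [∀ x, IsProbabilityMeasure (μ x)] : Measure Env :=
  Measure.infinitePi μ

instance (μ : ℤ → Measure ℝ) [∀ x, IsProbabilityMeasure (μ x)] :
    IsProbabilityMeasure (envLaw μ) := by
  unfold envLaw; infer_instance

/-- The annealed measure `ℙ_n = P̄ ⊗ P_n^ω` on `Ω × ℤ`; the position is the second coordinate. -/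
def annealed (μ : ℤ → Measure ℝ) [∀ x, IsProbabilityMeasure (μ x)] (n : ℕ) :
    Measure (Env × ℤ) :=
  envLaw μ ⊗ₘ quenched n

/-- Konno's density
`f_K(x) = 1 / (π (1 - x²) √(1 - 2x²))` on `(-1/√2, 1/√2)`, and `0` elsewhere. -/
def fK : ℝ → ℝ :=
  Set.indicator (Set.Ioo (-(1 / √2)) (1 / √2))
    fun x => 1 / (Real.pi * (1 - x ^ 2) * √(1 - 2 * x ^ 2))

end

end QWRE

namespace QWRE

noncomputable section

/-! The random phases can be gauged away. A diagonal unitary at each site, built from a discrete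
antiderivative of `ω`, intertwines the walk in `ω` with the homogeneous Hadamard walk, and unitary
diagonal factors do not change position probabilities. What remains of `ω` is a relative phase
`e^{-i ω_0}` in the initial state (`prob_eq_hadamard`), so the quenched law of `X_n` depends on
`ω_0` only.

The homogeneous walk is solved by Fourier analysis. Plancherel (`sum_exp_mul_prob`) writes the
characteristic function of `X_n` as an integral over `k` of inner products of `symbol k ^ n` and
`symbol (k - h) ^ n` applied to the state. The symbol has eigenvalues `i e^{± i θ(k)}` with `cos θ =
sin k / √2`. At `h = ξ / n` the phases within a band converge to `± ξ θ'(k)` up to sign, while the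
terms between bands vanish because the eigenspaces are orthogonal. Dominated convergence gives the
limit of the characteristic function.

By the symmetries `k ↦ -k` and `k ↦ π - k` the limit is the mean of `e^{iξv} (1 - sin ω_0 · v)`,
where `v` is the group velocity at a uniform `k` in `(0, π)`; such a `v` has density `f_K`
(`integral_fK_smul`). The limit is affine in `sin ω_0`, so averaging over environments merely
replaces `sin ω_0` by its mean. Lévy's continuity theorem and the portmanteau theorem finish the
proof. -/

/-! ### Gauge equivalence with the Hadamard walk -/

theorem exists_int_antidifference (f : ℤ → ℝ) :
    ∃ S : ℤ → ℝ, S 0 = 0 ∧ ∀ x, S (x + 1) = S x + f (x + 1) := by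
  refine ⟨fun x => match x with
    | Int.ofNat n => ∑ i ∈ Finset.range n, f (i + 1)
    | Int.negSucc n => -∑ i ∈ Finset.range (n + 1), f (-i), by simp, ?_⟩
  rintro (n | n)
  · have : (Int.ofNat n + 1 : ℤ) = Int.ofNat (n + 1) := rfl
    simp only [this, Finset.sum_range_succ]
    simp
  · rcases n with _ | n
    · have : (Int.negSucc 0 + 1 : ℤ) = Int.ofNat 0 := rfl
      simp only [this]
      simp
    · have : (Int.negSucc (n + 1) + 1 : ℤ) = Int.negSucc n := rfl
      simp only [this]
      rw [Finset.sum_range_succ _ (n + 1)]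
      have h : Int.negSucc n = -((n + 1 : ℕ) : ℤ) := rfl
      rw [h]; ring

/-- The diagonal gauge transformation with phases `-S x` and `-S (x - 1)`. -/
def gauge (S : ℤ → ℝ) (x : ℤ) : Matrix (Fin 2) (Fin 2) ℂ :=
  !![Complex.exp (-(Complex.I * S x)), 0; 0, Complex.exp (-(Complex.I * S (x - 1)))]

/-- The displacement of a step in direction `d`. -/
def displacement (d : Fin 2) : ℤ := if d = 0 then -1 else 1

theorem endpoint_snoc {n : ℕ} (s : Fin n → Fin 2) (d : Fin 2) :
    endpoint (Fin.snoc (α := fun _ => Fin 2) s d) = endpoint s + displacement d := by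
  simp only [endpoint, numSteps_snoc, displacement]
  fin_cases d <;> simp <;> ring

theorem endpoint_succ {n : ℕ} (s : Fin (n + 1) → Fin 2) :
    endpoint s = endpoint (Fin.init s) + displacement (s (Fin.last n)) := by
  conv_lhs => rw [← Fin.snoc_init_self s]
  exact endpoint_snoc _ _

/-- Since `S y - S (y - 1) = ω y`, the gauge at `y` makes the phases of both entries of the active
row equal: `-S (y - 1)` for a left step, `-S y` for a right step. These are the first gauge phase at
`y - 1` and the second at `y + 1`, which is why the two chiralities use `S` at shifted sites. -/
theorem step_mul_gauge {ω : Env} {S : ℤ → ℝ} (hS : ∀ x, S (x + 1) = S x + ω (x + 1))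
    (y : ℤ) (d : Fin 2) :
    step ω y d * gauge S y = gauge S (y + displacement d) * step 0 y d := by
  have h1 : S y = S (y - 1) + ω y := by simpa using hS (y - 1)
  have e1 : Complex.exp (Complex.I * ω y) * Complex.exp (-(Complex.I * S y)) =
      Complex.exp (-(Complex.I * S (y - 1))) := by
    rw [← Complex.exp_add, h1]; push_cast; ring_nf
  have e2 : Complex.exp (-(Complex.I * ω y)) * Complex.exp (-(Complex.I * S (y - 1))) =
      Complex.exp (-(Complex.I * S y)) := by
    rw [← Complex.exp_add, h1]; push_cast; ring_nf
  ext i j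
  fin_cases d <;> fin_cases i <;> fin_cases j <;>
    simp [step, stepL, stepR, gauge, displacement, coin, Matrix.mul_apply, Fin.sum_univ_two,
      mul_assoc, e1, e2, ← sub_eq_add_neg] <;> ring

theorem pathWeight_mul_gauge {ω : Env} {S : ℤ → ℝ} (hS : ∀ x, S (x + 1) = S x + ω (x + 1))
    (n : ℕ) (s : Fin n → Fin 2) :
    pathWeight ω n s * gauge S 0 = gauge S (endpoint s) * pathWeight 0 n s := by
  induction n with
  | zero => simp [pathWeight, endpoint, numSteps]
  | succ n ih =>
    rw [pathWeight, pathWeight, mul_assoc, ih, ← mul_assoc, step_mul_gauge hS, mul_assoc,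
      ← endpoint_succ]

theorem Xi_mul_gauge {ω : Env} {S : ℤ → ℝ} (hS : ∀ x, S (x + 1) = S x + ω (x + 1))
    (n l m : ℕ) :
    Xi ω n l m * gauge S 0 = gauge S (m - l) * Xi 0 n l m := by
  simp only [Xi, Finset.sum_mul, Finset.mul_sum]
  refine Finset.sum_congr rfl fun s hs => ?_
  rw [Finset.mem_filter] at hs
  rw [pathWeight_mul_gauge hS, endpoint, hs.2.1, hs.2.2]

theorem norm_gauge_mulVec (S : ℤ → ℝ) (x : ℤ) (v : Fin 2 → ℂ) :
    ‖WithLp.toLp 2 (gauge S x *ᵥ v)‖ = ‖WithLp.toLp 2 v‖ := by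
  have h (t : ℝ) : ‖Complex.exp (-(Complex.I * t))‖ = 1 := by
    rw [show -(Complex.I * t) = ((-t : ℝ) : ℂ) * Complex.I by push_cast; ring,
      Complex.norm_exp_ofReal_mul_I]
  simp [EuclideanSpace.norm_eq, gauge, dotProduct, Fin.sum_univ_two, h]

/-- The initial state `ᵀ[1/√2, i e^{-it}/√2]` of the Hadamard walk that is equivalent to the walk
in an environment with `ω_0 = t`. -/
def rotState (t : ℝ) : Fin 2 → ℂ :=
  ![((1 / √2 : ℝ) : ℂ), Complex.I * Complex.exp (-(Complex.I * t)) * ((1 / √2 : ℝ) : ℂ)]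

/-- Along a path the gauge factors telescope, leaving one at the end point, which is an isometry,
and one at the origin. With `S 0 = 0` and `S (-1) = -ω 0` the latter is `diag(1, e^{i ω_0})`, whose
inverse turns the initial state into `rotState (ω 0)`. -/
theorem prob_eq_hadamard (ω : Env) (n l m : ℕ) :
    prob ω n l m = ‖WithLp.toLp 2 (Xi 0 n l m *ᵥ rotState (ω 0))‖ ^ 2 := by
  obtain ⟨S, h0, hS⟩ := exists_int_antidifference ω
  have h1 : S (-1) = -ω 0 := by
    have := hS (-1)
    simp only [neg_add_cancel, h0] at this
    linarith
  have hφ : gauge S 0 *ᵥ rotState (ω 0) = initState := by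
    ext i
    fin_cases i
    · simp [gauge, rotState, initState, Matrix.mulVec, dotProduct, h0]
    · have : Complex.exp (Complex.I * ω 0) * Complex.exp (-(Complex.I * ω 0)) = 1 := by
        rw [← Complex.exp_add]; simp
      simp only [gauge, rotState, initState, Matrix.mulVec, dotProduct, Fin.sum_univ_two]
      simp [h1]
      linear_combination Complex.I * (√2 : ℂ)⁻¹ * this
  rw [prob, ← hφ, Matrix.mulVec_mulVec, Xi_mul_gauge hS, ← Matrix.mulVec_mulVec,
    norm_gauge_mulVec]

/-! ### Fourier representation and Plancherel's identity -/

/-- The Fourier symbol of one step of the Hadamard walk. -/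
def symbol (k : ℝ) : Matrix (Fin 2) (Fin 2) ℂ :=
  Complex.exp (Complex.I * k) • stepL 0 0 + Complex.exp (-(Complex.I * k)) • stepR 0 0

theorem symbol_pow_eq_sum_paths (k : ℝ) (n : ℕ) :
    symbol k ^ n =
      ∑ s : Fin n → Fin 2, Complex.exp (-(Complex.I * k * endpoint s)) • pathWeight 0 n s := by
  induction n with
  | zero => simp [endpoint, numSteps, pathWeight]
  | succ n ih =>
    rw [← (Fin.snocEquiv (fun _ : Fin (n + 1) => Fin 2)).sum_comp, Fintype.sum_prod_type,
      Fin.sum_univ_two, pow_succ', ih, Finset.mul_sum, ← Finset.sum_add_distrib]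
    refine Finset.sum_congr rfl fun s _ => ?_
    have hL (y : ℤ) : stepL 0 y = stepL 0 0 := rfl
    have hR (y : ℤ) : stepR 0 y = stepR 0 0 := rfl
    have e1 : Complex.exp (-(Complex.I * k * ((endpoint s + displacement 0 : ℤ) : ℂ))) =
        Complex.exp (Complex.I * k) * Complex.exp (-(Complex.I * k * endpoint s)) := by
      rw [← Complex.exp_add]; simp [displacement]; ring_nf
    have e2 : Complex.exp (-(Complex.I * k * ((endpoint s + displacement 1 : ℤ) : ℂ))) =
        Complex.exp (-(Complex.I * k)) * Complex.exp (-(Complex.I * k * endpoint s)) := by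
      rw [← Complex.exp_add]; simp [displacement]; ring_nf
    simp only [Fin.snocEquiv, Equiv.coe_fn_mk, endpoint_snoc, e1, e2, pathWeight,
      Fin.init_snoc, Fin.snoc_last, step, hL, hR, if_true]
    simp [symbol, add_mul, smul_smul, mul_comm]

theorem numSteps_add {n : ℕ} (s : Fin n → Fin 2) : numSteps s 0 + numSteps s 1 = n := by
  have h : (Finset.univ.filter fun j => s j = 1) = Finset.univ.filter fun j => ¬ s j = 0 := by
    ext j; simp; omega
  rw [numSteps, numSteps, h, Finset.card_filter_add_card_filter_not]
  simp

theorem symbol_pow_eq_sum_Xi (k : ℝ) (n : ℕ) :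
    symbol k ^ n = ∑ p ∈ Finset.HasAntidiagonal.antidiagonal n,
      Complex.exp (-(Complex.I * k * ((p.2 - p.1 : ℤ) : ℂ))) • Xi 0 n p.1 p.2 := by
  rw [symbol_pow_eq_sum_paths,
    ← Finset.sum_fiberwise_of_maps_to (s := Finset.univ)
      (t := Finset.HasAntidiagonal.antidiagonal n)
      (g := fun s : Fin n → Fin 2 => (numSteps s 0, numSteps s 1))
      (fun s _ => by simpa using numSteps_add s)]
  refine Finset.sum_congr rfl fun p _ => ?_
  simp only [Xi, Finset.smul_sum, Prod.ext_iff]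
  refine Finset.sum_congr rfl fun s hs => ?_
  rw [Finset.mem_filter] at hs
  rw [endpoint, ← hs.2.1, ← hs.2.2]

theorem integral_exp_int_mul (z : ℤ) :
    ∫ k in (-Real.pi)..Real.pi, Complex.exp (Complex.I * k * z) =
      if z = 0 then (2 * Real.pi : ℂ) else 0 := by
  split_ifs with h
  · subst h; simp; ring
  · have hc : Complex.I * z ≠ 0 := by simp [h]
    have : ∀ k : ℝ, Complex.I * k * z = Complex.I * z * k := fun k => by ring
    simp only [this]
    rw [integral_exp_mul_complex hc, div_eq_zero_iff]
    left
    rw [sub_eq_zero, Complex.exp_eq_exp_iff_exists_int]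
    exact ⟨z, by push_cast; ring⟩

/-- Orthogonality of characters on a period: shifting the argument of one factor by `h` multiplies
the coefficient at position `x` by `e^{ihx}`, so only the diagonal terms, with this weight, survive.
-/
theorem integral_conj_mul_shift_antidiagonal (n : ℕ) (c : ℕ × ℕ → ℂ) (h : ℝ) :
    ∫ k in (-Real.pi)..Real.pi,
      (starRingEnd ℂ) (∑ p ∈ Finset.HasAntidiagonal.antidiagonal n,
        Complex.exp (-(Complex.I * k * ((p.2 - p.1 : ℤ) : ℂ))) * c p) *
      (∑ p ∈ Finset.HasAntidiagonal.antidiagonal n,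
        Complex.exp (-(Complex.I * ((k - h : ℝ) : ℂ) * ((p.2 - p.1 : ℤ) : ℂ))) * c p) =
    2 * Real.pi * ∑ p ∈ Finset.HasAntidiagonal.antidiagonal n,
      Complex.exp (Complex.I * h * ((p.2 - p.1 : ℤ) : ℂ)) * ((‖c p‖ ^ 2 : ℝ) : ℂ) := by
  have key (k : ℝ) (p q : ℕ × ℕ) :
      (starRingEnd ℂ) (Complex.exp (-(Complex.I * k * ((p.2 - p.1 : ℤ) : ℂ))) * c p) *
        (Complex.exp (-(Complex.I * ((k - h : ℝ) : ℂ) * ((q.2 - q.1 : ℤ) : ℂ))) * c q) =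
      Complex.exp (Complex.I * k * (((p.2 - p.1) - (q.2 - q.1) : ℤ) : ℂ)) *
        (Complex.exp (Complex.I * h * ((q.2 - q.1 : ℤ) : ℂ)) * ((starRingEnd ℂ) (c p) * c q)) := by
    have : (starRingEnd ℂ) (Complex.exp (-(Complex.I * k * ((p.2 - p.1 : ℤ) : ℂ)))) *
        Complex.exp (-(Complex.I * ((k - h : ℝ) : ℂ) * ((q.2 - q.1 : ℤ) : ℂ))) =
        Complex.exp (Complex.I * k * (((p.2 - p.1) - (q.2 - q.1) : ℤ) : ℂ)) *
          Complex.exp (Complex.I * h * ((q.2 - q.1 : ℤ) : ℂ)) := by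
      rw [← Complex.exp_conj, ← Complex.exp_add, ← Complex.exp_add]
      congr 1
      simp
      ring
    rw [map_mul]
    linear_combination ((starRingEnd ℂ) (c p) * c q) * this
  simp only [map_sum, Finset.sum_mul_sum, key]
  rw [intervalIntegral.integral_finsetSum fun p _ => by
    apply Continuous.intervalIntegrable; fun_prop, Finset.mul_sum]
  refine Finset.sum_congr rfl fun p hp => ?_
  rw [intervalIntegral.integral_finsetSum fun p _ => by
    apply Continuous.intervalIntegrable; fun_prop]
  simp only [intervalIntegral.integral_mul_const, integral_exp_int_mul]
  rw [Finset.sum_eq_single p]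
  · simp [← Complex.normSq_eq_conj_mul_self, Complex.normSq_eq_norm_sq]
  · intro q hq hqp
    -- On a fixed antidiagonal the difference of the coordinates determines the pair.
    have : ((p.2 : ℤ) - p.1) - (q.2 - q.1) ≠ 0 := by
      intro h0
      rw [Finset.HasAntidiagonal.mem_antidiagonal] at hp hq
      exact hqp (Prod.ext (by omega) (by omega))
    simp [this]
  · exact fun h => absurd hp h

/-- Plancherel's identity for the characteristic function of the position. -/
theorem sum_exp_mul_prob (ω : Env) (n : ℕ) (h : ℝ) :
    ∑ p ∈ Finset.HasAntidiagonal.antidiagonal n,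
      Complex.exp (Complex.I * h * ((p.2 - p.1 : ℤ) : ℂ)) * (prob ω n p.1 p.2 : ℂ) =
    (2 * Real.pi : ℂ)⁻¹ * ∫ k in (-Real.pi)..Real.pi,
      star (symbol k ^ n *ᵥ rotState (ω 0)) ⬝ᵥ (symbol (k - h) ^ n *ᵥ rotState (ω 0)) := by
  have hpi : (2 * Real.pi : ℂ) ≠ 0 := by simp [Real.pi_ne_zero]
  rw [eq_inv_mul_iff_mul_eq₀ hpi]
  have hv (k : ℝ) (i : Fin 2) : (symbol k ^ n *ᵥ rotState (ω 0)) i =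
      ∑ p ∈ Finset.HasAntidiagonal.antidiagonal n,
        Complex.exp (-(Complex.I * k * ((p.2 - p.1 : ℤ) : ℂ))) *
          (Xi 0 n p.1 p.2 *ᵥ rotState (ω 0)) i := by
    rw [symbol_pow_eq_sum_Xi, Matrix.sum_mulVec, Finset.sum_apply]
    simp [Matrix.smul_mulVec]
  simp only [dotProduct, Fin.sum_univ_two, Pi.star_apply, hv]
  rw [intervalIntegral.integral_add]
  · simp only [← starRingEnd_apply]
    rw [integral_conj_mul_shift_antidiagonal, integral_conj_mul_shift_antidiagonal, ← mul_add,
      ← Finset.sum_add_distrib]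
    congr 1
    refine Finset.sum_congr rfl fun p _ => ?_
    rw [prob_eq_hadamard, norm_sq_toLp]
    simp only [Complex.normSq_eq_norm_sq]
    push_cast
    ring
  all_goals
    apply Continuous.intervalIntegrable
    fun_prop

/-! ### Spectral decomposition of the symbol -/

/-- The factor `1 / √(1 + cos² k)`. -/
def invRadius (k : ℝ) : ℝ := (√(1 + Real.cos k ^ 2))⁻¹

/-- The group velocity `cos k / √(1 + cos² k)` of the Hadamard walk. -/
def groupVelocity (k : ℝ) : ℝ := Real.cos k * invRadius k

/-- The quasi-energy of the Hadamard walk. -/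
def quasiEnergy (k : ℝ) : ℝ := Real.arccos (Real.sin k / √2)

/-- The Hermitian involution whose eigenspaces are those of the symbol. -/
def bandInvolution (k : ℝ) : Matrix (Fin 2) (Fin 2) ℂ :=
  (invRadius k : ℂ) •
    !![-(Real.cos k : ℂ), -(Complex.I * Real.sin k) - Real.cos k;
      Complex.I * Real.sin k - Real.cos k, (Real.cos k : ℂ)]

/-- The eigenprojections of the symbol, for `e = 1` and `e = -1`. -/
def bandProj (e : ℝ) (k : ℝ) : Matrix (Fin 2) (Fin 2) ℂ :=
  (1 / 2 : ℂ) • (1 + (e : ℂ) • bandInvolution k)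

theorem invRadius_pos (k : ℝ) : 0 < invRadius k := by
  unfold invRadius; positivity

theorem invRadius_sq (k : ℝ) : invRadius k ^ 2 * (1 + Real.cos k ^ 2) = 1 := by
  rw [invRadius, inv_pow, Real.sq_sqrt (by positivity), inv_mul_cancel₀ (by positivity)]

@[fun_prop]
theorem continuous_invRadius : Continuous invRadius := by
  unfold invRadius
  exact Continuous.inv₀ (by fun_prop) fun k => by positivity

@[fun_prop]
theorem continuous_groupVelocity : Continuous groupVelocity := by
  unfold groupVelocity; fun_prop

@[fun_prop]
theorem continuous_bandProj (e : ℝ) : Continuous (bandProj e) := by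
  have : Continuous bandInvolution := by
    unfold bandInvolution
    refine continuous_matrix fun i j => ?_
    fin_cases i <;> fin_cases j <;> simp <;> fun_prop
  unfold bandProj
  fun_prop

theorem bandInvolution_mul_self (k : ℝ) : bandInvolution k * bandInvolution k = 1 := by
  have h : (invRadius k : ℂ) ^ 2 * (1 + (Real.cos k : ℂ) ^ 2) = 1 := by
    exact_mod_cast invRadius_sq k
  have hs : (Real.sin k : ℂ) ^ 2 + (Real.cos k : ℂ) ^ 2 = 1 := by
    exact_mod_cast Real.sin_sq_add_cos_sq k
  have hI := Complex.I_sq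
  generalize hrr : (invRadius k : ℂ) = r at *
  generalize hcc : (Real.cos k : ℂ) = c at *
  generalize hss : (Real.sin k : ℂ) = s at *
  unfold bandInvolution
  rw [hrr, hcc, hss]
  ext i j
  fin_cases i <;> fin_cases j <;>
    simp [Matrix.mul_apply, Fin.sum_univ_two]
  · linear_combination h + r ^ 2 * hs - r ^ 2 * s ^ 2 * hI
  · ring
  · ring
  · linear_combination h + r ^ 2 * hs - r ^ 2 * s ^ 2 * hI

theorem bandProj_mul (a b : ℝ) (k : ℝ) :
    bandProj a k * bandProj b k =
      (1 / 4 : ℂ) • ((1 + a * b : ℂ) • 1 + (a + b : ℂ) • bandInvolution k) := by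
  simp only [bandProj, smul_mul_assoc, mul_smul_comm, add_mul, mul_add, one_mul, mul_one,
    bandInvolution_mul_self, smul_add, smul_smul, add_smul]
  module

theorem bandProj_mul_self {e : ℝ} (he : e ^ 2 = 1) (k : ℝ) :
    bandProj e k * bandProj e k = bandProj e k := by
  have : (e : ℂ) * e = 1 := by exact_mod_cast (sq e) ▸ he
  rw [bandProj_mul, this, bandProj]
  module

theorem bandProj_mul_neg {e : ℝ} (he : e ^ 2 = 1) (k : ℝ) :
    bandProj e k * bandProj (-e) k = 0 := by
  have : (e : ℂ) * e = 1 := by exact_mod_cast (sq e) ▸ he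
  rw [bandProj_mul]
  push_cast
  simp [this]

theorem bandProj_conjTranspose (e k : ℝ) : (bandProj e k)ᴴ = bandProj e k := by
  ext i j
  fin_cases i <;> fin_cases j <;>
    simp [bandProj, bandInvolution, Matrix.conjTranspose_apply, -Complex.ofReal_cos,
      -Complex.ofReal_sin, sub_eq_add_neg, mul_add]

theorem cos_quasiEnergy (k : ℝ) : Real.cos (quasiEnergy k) = Real.sin k / √2 := by
  have h2 : 1 ≤ √2 := Real.one_le_sqrt.2 (by norm_num)
  have : |Real.sin k / √2| ≤ 1 := by
    rw [abs_div, abs_of_pos (by positivity : 0 < √2), div_le_one (by positivity)]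
    exact (Real.abs_sin_le_one k).trans h2
  exact Real.cos_arccos (abs_le.1 this).1 (abs_le.1 this).2

theorem one_sub_sq_sin_div (k : ℝ) :
    1 - (Real.sin k / √2) ^ 2 = (1 + Real.cos k ^ 2) / 2 := by
  rw [div_pow, Real.sq_sqrt (by norm_num), Real.cos_sq']
  ring

theorem sin_quasiEnergy (k : ℝ) : Real.sin (quasiEnergy k) = (√2 * invRadius k)⁻¹ := by
  rw [quasiEnergy, Real.sin_arccos, one_sub_sq_sin_div, Real.sqrt_div (by positivity), invRadius,
    mul_inv, inv_inv, mul_comm, div_eq_mul_inv]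

/-- The symbol has determinant `-1` and trace `i √2 sin k`, so its eigenvalues are `i e^{± iθ}` with
`2 cos θ = √2 sin k`. Taking `θ` as an arccosine fixes `sin θ > 0`. -/
theorem symbol_eq (k : ℝ) :
    symbol k = Complex.I • (Complex.exp (Complex.I * quasiEnergy k) • bandProj 1 k +
      Complex.exp (-(Complex.I * quasiEnergy k)) • bandProj (-1) k) := by
  have e1 : Complex.exp (Complex.I * quasiEnergy k) =
      (Real.sin k / √2 : ℝ) + Complex.I * ((√2 * invRadius k)⁻¹ : ℝ) := by
    rw [mul_comm, Complex.exp_mul_I, ← Complex.ofReal_cos, ← Complex.ofReal_sin, cos_quasiEnergy,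
      sin_quasiEnergy, mul_comm]
  have e2 : Complex.exp (-(Complex.I * quasiEnergy k)) =
      (Real.sin k / √2 : ℝ) - Complex.I * ((√2 * invRadius k)⁻¹ : ℝ) := by
    rw [show -(Complex.I * quasiEnergy k : ℂ) = (-quasiEnergy k : ℂ) * Complex.I by ring,
      Complex.exp_mul_I, Complex.cos_neg, Complex.sin_neg, ← Complex.ofReal_cos,
      ← Complex.ofReal_sin, cos_quasiEnergy, sin_quasiEnergy]
    ring
  have f1 : Complex.exp (Complex.I * k) = Real.cos k + Complex.I * Real.sin k := by
    rw [mul_comm, Complex.exp_mul_I, ← Complex.ofReal_cos, ← Complex.ofReal_sin, mul_comm]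
  have f2 : Complex.exp (-(Complex.I * k)) = Real.cos k - Complex.I * Real.sin k := by
    rw [show -(Complex.I * k : ℂ) = (-k : ℂ) * Complex.I by ring, Complex.exp_mul_I,
      Complex.cos_neg, Complex.sin_neg, ← Complex.ofReal_cos, ← Complex.ofReal_sin]
    ring
  have hr : (invRadius k : ℂ) ≠ 0 := by exact_mod_cast (invRadius_pos k).ne'
  have h2 : (√2 : ℂ) ≠ 0 := by exact_mod_cast (by positivity : √2 ≠ 0)
  have hI := Complex.I_sq
  rw [e1, e2, symbol, f1, f2]
  unfold bandProj bandInvolution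
  push_cast
  generalize (invRadius k : ℂ) = r at *
  rw [← Complex.ofReal_cos, ← Complex.ofReal_sin]
  generalize (Real.cos k : ℂ) = c at *
  generalize (Real.sin k : ℂ) = s at *
  ext i j
  fin_cases i <;> fin_cases j <;>
    (simp [stepL, stepR, coin]; field_simp; ring_nf) <;> (simp [hI]; try ring)

theorem symbol_pow (k : ℝ) (n : ℕ) :
    symbol k ^ n = Complex.I ^ n •
      (Complex.exp (Complex.I * (n * quasiEnergy k : ℝ)) • bandProj 1 k +
        Complex.exp (-(Complex.I * (n * quasiEnergy k : ℝ))) • bandProj (-1) k) := by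
  induction n with
  | zero =>
    simp [bandProj]
    module
  | succ n ih =>
    have h1 := bandProj_mul_self (e := 1) (by norm_num) k
    have h2 := bandProj_mul_self (e := -1) (by norm_num) k
    have h3 := bandProj_mul_neg (e := 1) (by norm_num) k
    have h4 := bandProj_mul_neg (e := -1) (by norm_num) k
    rw [neg_neg] at h4
    have e1 : Complex.exp (Complex.I * ((n + 1 : ℕ) * quasiEnergy k : ℝ)) =
        Complex.exp (Complex.I * (n * quasiEnergy k : ℝ)) *
          Complex.exp (Complex.I * quasiEnergy k) := by
      rw [← Complex.exp_add]; push_cast; ring_nf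
    have e2 : Complex.exp (-(Complex.I * ((n + 1 : ℕ) * quasiEnergy k : ℝ))) =
        Complex.exp (-(Complex.I * (n * quasiEnergy k : ℝ))) *
          Complex.exp (-(Complex.I * quasiEnergy k)) := by
      rw [← Complex.exp_add]; push_cast; ring_nf
    rw [pow_succ, ih, symbol_eq, e1, e2]
    simp only [smul_mul_assoc, mul_smul_comm, add_mul, mul_add, h1, h2, h3, h4, smul_zero,
      add_zero, zero_add, smul_add, smul_smul]
    congr 2 <;> ring

/-! ### Pointwise limit of the Plancherel integrand -/

/-- The component of the initial state in an energy band. -/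
def bandState (t e k : ℝ) : Fin 2 → ℂ := bandProj e k *ᵥ rotState t

theorem continuous_bandState (t e : ℝ) : Continuous (bandState t e) := by
  unfold bandState; fun_prop

theorem star_bandState_dotProduct (t a b k : ℝ) :
    star (bandState t a k) ⬝ᵥ bandState t b k =
      star (rotState t) ⬝ᵥ ((bandProj a k * bandProj b k) *ᵥ rotState t) := by
  rw [bandState, bandState, Matrix.star_mulVec, bandProj_conjTranspose,
    ← Matrix.dotProduct_mulVec, Matrix.mulVec_mulVec]

theorem star_bandState_dotProduct_neg (t k : ℝ) {e : ℝ} (he : e ^ 2 = 1) :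
    star (bandState t e k) ⬝ᵥ bandState t (-e) k = 0 := by
  rw [star_bandState_dotProduct, bandProj_mul_neg he, Matrix.zero_mulVec, dotProduct_zero]

theorem star_bandState_dotProduct_self (t k : ℝ) {e : ℝ} (he : e ^ 2 = 1) :
    star (bandState t e k) ⬝ᵥ bandState t e k =
      ((1 + e * (Real.sin k * Real.cos t * invRadius k - groupVelocity k * Real.sin t)) / 2 :
        ℝ) := by
  have f1 : Complex.exp (-(Complex.I * t)) = Real.cos t - Complex.I * Real.sin t := by
    rw [show -(Complex.I * t : ℂ) = (-t : ℂ) * Complex.I by ring, Complex.exp_mul_I,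
      Complex.cos_neg, Complex.sin_neg, ← Complex.ofReal_cos, ← Complex.ofReal_sin]
    ring
  have h2 : (√2 : ℂ)⁻¹ ^ 2 = 1 / 2 := by
    rw [inv_pow, ← Complex.ofReal_pow, Real.sq_sqrt (by norm_num)]
    norm_num
  have ht : (Real.sin t : ℂ) ^ 2 + (Real.cos t : ℂ) ^ 2 = 1 := by
    exact_mod_cast Real.sin_sq_add_cos_sq t
  have hI := Complex.I_sq
  rw [star_bandState_dotProduct, bandProj_mul_self he, groupVelocity]
  simp only [rotState, f1, bandProj, bandInvolution]
  push_cast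
  simp only [← Complex.ofReal_cos, ← Complex.ofReal_sin]
  simp [dotProduct, Matrix.mulVec, Fin.sum_univ_two, -Complex.ofReal_cos, -Complex.ofReal_sin]
  generalize (Real.cos k : ℂ) = c at *
  generalize (Real.sin k : ℂ) = s at *
  generalize (Real.cos t : ℂ) = u at *
  generalize (Real.sin t : ℂ) = w at *
  generalize (invRadius k : ℂ) = r at *
  generalize (√2 : ℂ)⁻¹ = q at *
  have hI4 : Complex.I ^ 4 = 1 := Complex.I_pow_four
  ring_nf
  simp only [h2, hI, hI4]
  -- Only the second amplitude of the state carries `t`; its modulus squared is `(cos² t + sin² t) /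
  -- 2`, multiplied by the lower diagonal entry `(1 + e r c) / 2` of the projection.
  linear_combination (1 + (e : ℂ) * r * c) / 4 * ht

/-- The bound `|sin k| / √2 < 1` is strict, so the arccosine stays away from its singular points and
the two bands never touch. -/
theorem hasDerivAt_quasiEnergy (k : ℝ) : HasDerivAt quasiEnergy (-groupVelocity k) k := by
  have h2 : 1 < √2 := Real.lt_sqrt_of_sq_lt (by norm_num)
  have hlt : |Real.sin k / √2| < 1 := by
    rw [abs_div, abs_of_pos (by positivity : 0 < √2), div_lt_one (by positivity)]
    exact (Real.abs_sin_le_one k).trans_lt h2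
  have h := (Real.hasDerivAt_arccos (abs_lt.1 hlt).1.ne' (abs_lt.1 hlt).2.ne).comp k
    ((Real.hasDerivAt_sin k).div_const √2)
  refine h.congr_deriv ?_
  rw [one_sub_sq_sin_div, Real.sqrt_div (by positivity), groupVelocity, invRadius]
  have : √(1 + Real.cos k ^ 2) ≠ 0 := by positivity
  field_simp

theorem tendsto_mul_quasiEnergy_sub (k ξ : ℝ) :
    Tendsto (fun n : ℕ => n * (quasiEnergy (k - ξ / n) - quasiEnergy k)) atTop
      (𝓝 (ξ * groupVelocity k)) := by
  have h1 : HasDerivAt (fun h : ℝ => quasiEnergy (k - ξ * h)) (ξ * groupVelocity k) 0 := by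
    have hk : HasDerivAt quasiEnergy (-groupVelocity k) (k - ξ * 0) := by
      simpa using hasDerivAt_quasiEnergy k
    have := hk.comp (0 : ℝ) (((hasDerivAt_id (0 : ℝ)).const_mul ξ).const_sub k)
    exact this.congr_deriv (by ring)
  have h2 := h1.tendsto_slope_zero
  -- The limit is a difference quotient with increment `1 / n`, which is nonzero only for `n > 0`.
  have h3 : Tendsto (fun n : ℕ => (n : ℝ)⁻¹) atTop (𝓝[≠] 0) :=
    tendsto_nhdsWithin_iff.2 ⟨tendsto_inv_atTop_nhds_zero_nat, by
      filter_upwards [eventually_gt_atTop 0] with n hn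
      simp; omega⟩
  refine (h2.comp h3).congr fun n => ?_
  simp [div_eq_mul_inv]

theorem tendsto_star_bandState_dotProduct (t a b k ξ : ℝ) :
    Tendsto (fun n : ℕ => star (bandState t a k) ⬝ᵥ bandState t b (k - ξ / n)) atTop
      (𝓝 (star (bandState t a k) ⬝ᵥ bandState t b k)) := by
  have h1 : Continuous fun x => star (bandState t a k) ⬝ᵥ bandState t b x :=
    continuous_const.dotProduct (continuous_bandState t b)
  have h2 : Tendsto (fun n : ℕ => k - ξ / n) atTop (𝓝 k) := by
    simpa using (tendsto_const_div_atTop_nhds_zero_nat ξ).const_sub k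
  exact (h1.tendsto k).comp h2

theorem tendsto_exp_mul_of_tendsto_zero (f : ℕ → ℝ) {g : ℕ → ℂ} (hg : Tendsto g atTop (𝓝 0)) :
    Tendsto (fun n => Complex.exp (Complex.I * f n) * g n) atTop (𝓝 0) := by
  rw [tendsto_zero_iff_norm_tendsto_zero] at hg ⊢
  refine hg.congr fun n => ?_
  rw [norm_mul, mul_comm Complex.I, Complex.norm_exp_ofReal_mul_I, one_mul]

/-- The terms are grouped by their behaviour at `k' = k - ξ / n`: within a band the phase is `n`
times a difference of energies and converges, whereas between bands it need not converge but
multiplies an overlap that tends to zero. -/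
theorem star_symbol_pow_dotProduct (t k k' : ℝ) (n : ℕ) :
    star (symbol k ^ n *ᵥ rotState t) ⬝ᵥ (symbol k' ^ n *ᵥ rotState t) =
      Complex.exp (Complex.I * (n * (quasiEnergy k' - quasiEnergy k) : ℝ)) *
          (star (bandState t 1 k) ⬝ᵥ bandState t 1 k') +
        Complex.exp (-(Complex.I * (n * (quasiEnergy k' - quasiEnergy k) : ℝ))) *
          (star (bandState t (-1) k) ⬝ᵥ bandState t (-1) k') +
        (Complex.exp (Complex.I * (n * (-quasiEnergy k' - quasiEnergy k) : ℝ)) *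
          (star (bandState t 1 k) ⬝ᵥ bandState t (-1) k') +
        Complex.exp (Complex.I * (n * (quasiEnergy k' + quasiEnergy k) : ℝ)) *
          (star (bandState t (-1) k) ⬝ᵥ bandState t 1 k')) := by
  have hI : star (Complex.I ^ n) * Complex.I ^ n = 1 := by
    rw [star_pow, ← mul_pow]; simp
  have c1 (x : ℝ) : star (Complex.exp (Complex.I * x)) = Complex.exp (-(Complex.I * x)) := by
    rw [← starRingEnd_apply, ← Complex.exp_conj]; simp
  have c2 (x : ℝ) : star (Complex.exp (-(Complex.I * x))) = Complex.exp (Complex.I * x) := by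
    rw [← c1, star_star]
  rw [symbol_pow, symbol_pow]
  simp only [Matrix.smul_mulVec, Matrix.add_mulVec, bandState, star_smul, star_add,
    smul_dotProduct, dotProduct_smul, add_dotProduct, dotProduct_add, smul_eq_mul, c1, c2]
  have e1 : Complex.exp (Complex.I * (n * (quasiEnergy k' - quasiEnergy k) : ℝ)) =
      Complex.exp (Complex.I * (n * quasiEnergy k' : ℝ)) *
        Complex.exp (-(Complex.I * (n * quasiEnergy k : ℝ))) := by
    rw [← Complex.exp_add]; push_cast; ring_nf
  have e2 : Complex.exp (-(Complex.I * (n * (quasiEnergy k' - quasiEnergy k) : ℝ))) =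
      Complex.exp (-(Complex.I * (n * quasiEnergy k' : ℝ))) *
        Complex.exp (Complex.I * (n * quasiEnergy k : ℝ)) := by
    rw [← Complex.exp_add]; push_cast; ring_nf
  have e3 : Complex.exp (Complex.I * (n * (-quasiEnergy k' - quasiEnergy k) : ℝ)) =
      Complex.exp (-(Complex.I * (n * quasiEnergy k' : ℝ))) *
        Complex.exp (-(Complex.I * (n * quasiEnergy k : ℝ))) := by
    rw [← Complex.exp_add]; push_cast; ring_nf
  have e4 : Complex.exp (Complex.I * (n * (quasiEnergy k' + quasiEnergy k) : ℝ)) =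
      Complex.exp (Complex.I * (n * quasiEnergy k' : ℝ)) *
        Complex.exp (Complex.I * (n * quasiEnergy k : ℝ)) := by
    rw [← Complex.exp_add]; push_cast; ring_nf
  rw [e1, e2, e3, e4]
  generalize star (Complex.I ^ n) = J at *
  generalize Complex.I ^ n = K at *
  generalize star (bandProj 1 k *ᵥ rotState t) ⬝ᵥ (bandProj 1 k' *ᵥ rotState t) = w1
  generalize star (bandProj 1 k *ᵥ rotState t) ⬝ᵥ (bandProj (-1) k' *ᵥ rotState t) = w2
  generalize star (bandProj (-1) k *ᵥ rotState t) ⬝ᵥ (bandProj 1 k' *ᵥ rotState t) = w3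
  generalize star (bandProj (-1) k *ᵥ rotState t) ⬝ᵥ (bandProj (-1) k' *ᵥ rotState t) = w4
  generalize Complex.exp (Complex.I * (n * quasiEnergy k' : ℝ)) = x1
  generalize Complex.exp (Complex.I * (n * quasiEnergy k : ℝ)) = x2
  generalize Complex.exp (-(Complex.I * (n * quasiEnergy k' : ℝ))) = x3
  generalize Complex.exp (-(Complex.I * (n * quasiEnergy k : ℝ))) = x4
  linear_combination (x1 * x4 * w1 + x3 * x2 * w4 + x3 * x4 * w2 + x1 * x2 * w3) * hI

/-- The pointwise limit of the integrand in Plancherel's identity. -/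
def limitIntegrand (ξ t k : ℝ) : ℂ :=
  Complex.exp (Complex.I * (ξ * groupVelocity k : ℝ)) *
      ((1 + (Real.sin k * Real.cos t * invRadius k - groupVelocity k * Real.sin t)) / 2 : ℝ) +
    Complex.exp (-(Complex.I * (ξ * groupVelocity k : ℝ))) *
      ((1 - (Real.sin k * Real.cos t * invRadius k - groupVelocity k * Real.sin t)) / 2 : ℝ)

theorem tendsto_star_symbol_pow_dotProduct (ξ t k : ℝ) :
    Tendsto (fun n : ℕ =>
      star (symbol k ^ n *ᵥ rotState t) ⬝ᵥ (symbol (k - ξ / n) ^ n *ᵥ rotState t))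
      atTop (𝓝 (limitIntegrand ξ t k)) := by
  have hE : Tendsto (fun n : ℕ =>
      Complex.I * ((n * (quasiEnergy (k - ξ / n) - quasiEnergy k) : ℝ) : ℂ)) atTop
      (𝓝 (Complex.I * (ξ * groupVelocity k : ℝ))) :=
    ((Complex.continuous_ofReal.tendsto _).comp (tendsto_mul_quasiEnergy_sub k ξ)).const_mul _
  have h1 := ((Complex.continuous_exp.tendsto _).comp hE).mul
    (tendsto_star_bandState_dotProduct t 1 1 k ξ)
  have h2 := ((Complex.continuous_exp.tendsto _).comp hE.neg).mul
    (tendsto_star_bandState_dotProduct t (-1) (-1) k ξ)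
  have z3 := tendsto_star_bandState_dotProduct t 1 (-1) k ξ
  have z4 := tendsto_star_bandState_dotProduct t (-1) 1 k ξ
  have o4 := star_bandState_dotProduct_neg t k (e := -1) (by norm_num)
  rw [neg_neg] at o4
  rw [star_bandState_dotProduct_neg t k (by norm_num)] at z3
  rw [o4] at z4
  have h3 := tendsto_exp_mul_of_tendsto_zero
    (fun n : ℕ => n * (-quasiEnergy (k - ξ / n) - quasiEnergy k)) z3
  have h4 := tendsto_exp_mul_of_tendsto_zero
    (fun n : ℕ => n * (quasiEnergy (k - ξ / n) + quasiEnergy k)) z4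
  have h := (h1.add h2).add (h3.add h4)
  rw [star_bandState_dotProduct_self t k (by norm_num),
    star_bandState_dotProduct_self t k (by norm_num)] at h
  simp only [star_symbol_pow_dotProduct]
  convert! h using 2
  rw [limitIntegrand]
  push_cast
  ring

/-! ### Domination and the limit in a fixed environment -/

theorem symbol_mem_unitaryGroup (k : ℝ) : symbol k ∈ Matrix.unitaryGroup (Fin 2) ℂ := by
  have h1 : Complex.exp (Complex.I * k) * Complex.exp (-(Complex.I * k)) = 1 := by
    rw [← Complex.exp_add]; simp
  have c1 : (starRingEnd ℂ) (Complex.exp (Complex.I * k)) = Complex.exp (-(Complex.I * k)) := by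
    rw [← Complex.exp_conj]; simp
  have c2 : (starRingEnd ℂ) (Complex.exp (-(Complex.I * k))) = Complex.exp (Complex.I * k) := by
    rw [← Complex.exp_conj]; simp
  have h2 : (√2 : ℂ)⁻¹ ^ 2 = 1 / 2 := by
    rw [inv_pow, ← Complex.ofReal_pow, Real.sq_sqrt (by norm_num)]
    norm_num
  rw [Matrix.mem_unitaryGroup_iff]
  ext i j
  fin_cases i <;> fin_cases j <;>
    simp [symbol, stepL, stepR, coin, Matrix.mul_apply, Fin.sum_univ_two, c1, c2] <;>
    generalize Complex.exp (-(Complex.I * k)) = x at * <;>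
    generalize Complex.exp (Complex.I * k) = y at * <;>
    generalize (√2 : ℂ)⁻¹ = q at *
  · linear_combination 2 * q ^ 2 * h1 + 2 * h2
  · linear_combination 2 * q ^ 2 * h1 + 2 * h2

/-- Entries of a unitary matrix and of the state have modulus at most one, so each coordinate is at
most 2 and the inner product at most `4 + 4`. Only uniformity in `n` and `k` matters. -/
theorem norm_star_symbol_pow_dotProduct_le (t k k' : ℝ) (n : ℕ) :
    ‖star (symbol k ^ n *ᵥ rotState t) ⬝ᵥ (symbol k' ^ n *ᵥ rotState t)‖ ≤ 8 := by
  have hs : ‖((√2)⁻¹ : ℂ)‖ ≤ 1 := by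
    rw [norm_inv, Complex.norm_real, Real.norm_of_nonneg (by positivity)]
    exact inv_le_one_of_one_le₀ (Real.one_le_sqrt.2 (by norm_num))
  have hexp : ‖Complex.exp (-(Complex.I * t))‖ = 1 := by
    rw [show -(Complex.I * t) = ((-t : ℝ) : ℂ) * Complex.I by push_cast; ring,
      Complex.norm_exp_ofReal_mul_I]
  have h0 (i : Fin 2) : ‖rotState t i‖ ≤ 1 := by
    fin_cases i
    · simpa [rotState] using hs
    · simpa [rotState, hexp] using hs
  have h1 (k : ℝ) (i : Fin 2) : ‖(symbol k ^ n *ᵥ rotState t) i‖ ≤ 2 := by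
    have hu := entry_norm_bound_of_unitary (pow_mem (symbol_mem_unitaryGroup k) n)
    rw [Matrix.mulVec, dotProduct, Fin.sum_univ_two]
    refine (norm_add_le _ _).trans ?_
    rw [norm_mul, norm_mul]
    have := mul_le_one₀ (hu i 0) (norm_nonneg _) (h0 0)
    have := mul_le_one₀ (hu i 1) (norm_nonneg _) (h0 1)
    linarith
  rw [dotProduct, Fin.sum_univ_two]
  refine (norm_add_le _ _).trans ?_
  rw [norm_mul, norm_mul, Pi.star_apply, Pi.star_apply, norm_star, norm_star]
  have := mul_le_mul (h1 k 0) (h1 k' 0) (norm_nonneg _) (by norm_num)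
  have := mul_le_mul (h1 k 1) (h1 k' 1) (norm_nonneg _) (by norm_num)
  linarith

theorem continuous_symbol : Continuous symbol := by
  unfold symbol; fun_prop

theorem tendsto_sum_exp_mul_prob (ω : Env) (ξ : ℝ) :
    Tendsto (fun n : ℕ => ∑ p ∈ Finset.HasAntidiagonal.antidiagonal n,
      Complex.exp (Complex.I * (ξ / n : ℝ) * ((p.2 - p.1 : ℤ) : ℂ)) * (prob ω n p.1 p.2 : ℂ))
      atTop (𝓝 ((2 * Real.pi : ℂ)⁻¹ *
        ∫ k in (-Real.pi)..Real.pi, limitIntegrand ξ (ω 0) k)) := by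
  simp only [sum_exp_mul_prob]
  refine Tendsto.const_mul _ ?_
  refine intervalIntegral.tendsto_integral_filter_of_dominated_convergence (fun _ => 8) ?_ ?_
    (by simp) ?_
  · refine Eventually.of_forall fun n => Continuous.aestronglyMeasurable ?_
    have := continuous_symbol
    exact (((this.pow n).matrix_mulVec continuous_const).star).dotProduct
      (((this.comp (continuous_id.sub continuous_const)).pow n).matrix_mulVec continuous_const)
  · exact Eventually.of_forall fun n => ae_of_all _ fun k _ =>
      norm_star_symbol_pow_dotProduct_le _ _ _ _
  · exact ae_of_all _ fun k _ => tendsto_star_symbol_pow_dotProduct ξ (ω 0) k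

/-! ### From quasi-momentum to group velocity -/

theorem groupVelocity_neg (k : ℝ) : groupVelocity (-k) = groupVelocity k := by
  simp [groupVelocity, invRadius]

theorem groupVelocity_pi_sub (k : ℝ) : groupVelocity (Real.pi - k) = -groupVelocity k := by
  simp [groupVelocity, invRadius]

theorem integral_limitIntegrand (ξ t : ℝ) :
    (2 * Real.pi : ℂ)⁻¹ * ∫ k in (-Real.pi)..Real.pi, limitIntegrand ξ t k =
      (Real.pi⁻¹ : ℝ) • ∫ k in (0 : ℝ)..Real.pi,
        Complex.exp (ξ * groupVelocity k * Complex.I) * (1 - Real.sin t * groupVelocity k) := by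
  have hf : Continuous (limitIntegrand ξ t) := by
    unfold limitIntegrand; fun_prop
  set A : ℝ → ℂ := fun k =>
    Complex.exp (ξ * groupVelocity k * Complex.I) * (1 - Real.sin t * groupVelocity k) with hA
  have hAc : Continuous A := by fun_prop
  -- Adding the values at `k` and `-k` cancels the `cos t` term, which is odd in `k`. The second
  -- band then equals the first one reflected by `k ↦ π - k`, which reverses the velocity.
  have hsum (k : ℝ) : limitIntegrand ξ t k + limitIntegrand ξ t (-k) = A k + A (Real.pi - k) := by
    have hr : invRadius (-k) = invRadius k := by simp [invRadius]
    simp only [limitIntegrand, hA, groupVelocity_neg, groupVelocity_pi_sub, hr, Real.sin_neg]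
    push_cast
    rw [show (ξ : ℂ) * -(groupVelocity k) * Complex.I =
      -(Complex.I * (ξ * groupVelocity k)) by ring,
      show (ξ : ℂ) * (groupVelocity k) * Complex.I = Complex.I * (ξ * groupVelocity k) by ring]
    ring
  have h1 : ∫ k in (-Real.pi)..Real.pi, limitIntegrand ξ t k =
      ∫ k in (0 : ℝ)..Real.pi, (limitIntegrand ξ t k + limitIntegrand ξ t (-k)) := by
    rw [intervalIntegral.integral_add (hf.intervalIntegrable _ _)
      (Continuous.intervalIntegrable (by fun_prop) _ _),
      intervalIntegral.integral_comp_neg (limitIntegrand ξ t), neg_zero, add_comm,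
      intervalIntegral.integral_add_adjacent_intervals] <;>
    exact hf.intervalIntegrable _ _
  have h2 : ∫ k in (0 : ℝ)..Real.pi, (A k + A (Real.pi - k)) =
      2 * ∫ k in (0 : ℝ)..Real.pi, A k := by
    rw [intervalIntegral.integral_add (hAc.intervalIntegrable _ _)
      (Continuous.intervalIntegrable (by fun_prop) _ _),
      intervalIntegral.integral_comp_sub_left A, sub_self, sub_zero]
    ring
  simp only [h1, hsum, h2, Complex.real_smul]
  have hpi : (Real.pi : ℂ) ≠ 0 := by simp [Real.pi_ne_zero]
  push_cast
  field_simp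

theorem one_sub_groupVelocity_sq (k : ℝ) : 1 - groupVelocity k ^ 2 = invRadius k ^ 2 := by
  rw [groupVelocity]
  linear_combination -invRadius_sq k

theorem one_sub_two_mul_groupVelocity_sq (k : ℝ) :
    1 - 2 * groupVelocity k ^ 2 = (Real.sin k * invRadius k) ^ 2 := by
  have h := invRadius_sq k
  rw [groupVelocity, mul_pow, mul_pow, Real.sin_sq]
  linear_combination -h

/-- With `v` the velocity and `r = invRadius k`, `1 - v² = r²` and `1 - 2v² = (sin k · r)²`, so the
density at `v` is exactly `1 / π` over the Jacobian `sin k · r³`. -/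
theorem fK_groupVelocity {k : ℝ} (hk : k ∈ Set.Ioo 0 Real.pi) :
    groupVelocity k ∈ Set.Ioo (-(1 / √2)) (1 / √2) ∧
      Real.sin k * invRadius k ^ 3 * fK (groupVelocity k) = Real.pi⁻¹ := by
  have hs := Real.sin_pos_of_pos_of_lt_pi hk.1 hk.2
  have hr := invRadius_pos k
  have h1 := one_sub_two_mul_groupVelocity_sq k
  have hmem : groupVelocity k ∈ Set.Ioo (-(1 / √2)) (1 / √2) := by
    refine abs_lt.1 (abs_lt_of_sq_lt_sq ?_ (by positivity))
    rw [div_pow, Real.sq_sqrt (by norm_num)]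
    have : 0 < (Real.sin k * invRadius k) ^ 2 := by positivity
    linarith
  refine ⟨hmem, ?_⟩
  rw [fK, Set.indicator_of_mem hmem, h1, one_sub_groupVelocity_sq, Real.sqrt_sq (by positivity)]
  have := Real.pi_pos
  field_simp

theorem hasDerivAt_groupVelocity (k : ℝ) :
    HasDerivAt groupVelocity (-(Real.sin k * invRadius k ^ 3)) k := by
  have hq : 0 < √(1 + Real.cos k ^ 2) := by positivity
  have h1 : HasDerivAt (fun k => 1 + Real.cos k ^ 2) (2 * Real.cos k * -Real.sin k) k := by
    simpa using ((Real.hasDerivAt_cos k).pow 2).const_add 1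
  have h2 := (h1.sqrt (by positivity)).inv hq.ne'
  refine ((Real.hasDerivAt_cos k).mul h2).congr_deriv ?_
  have hsq : √(1 + Real.cos k ^ 2) ^ 2 = 1 + Real.cos k ^ 2 := Real.sq_sqrt (by positivity)
  simp only [invRadius]
  field_simp
  simp only [Pi.inv_apply]
  field_simp
  linear_combination (-Real.sin k) * hsq

theorem arccos_groupVelocity {k : ℝ} (hk : k ∈ Set.Ioo 0 Real.pi) :
    Real.arccos (groupVelocity k / √(1 - groupVelocity k ^ 2)) = k := by
  have hr := invRadius_pos k
  rw [one_sub_groupVelocity_sq, Real.sqrt_sq hr.le, groupVelocity, mul_div_assoc,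
    div_self hr.ne', mul_one, Real.arccos_cos hk.1.le hk.2.le]

theorem injOn_groupVelocity : Set.InjOn groupVelocity (Set.Ioo 0 Real.pi) :=
  fun a ha b hb hab => by
    rw [← arccos_groupVelocity ha, ← arccos_groupVelocity hb, hab]

theorem image_groupVelocity :
    groupVelocity '' Set.Ioo 0 Real.pi = Set.Ioo (-(1 / √2)) (1 / √2) := by
  refine Set.Subset.antisymm ?_ fun x hx => ?_
  · rintro _ ⟨k, hk, rfl⟩
    exact (fK_groupVelocity hk).1
  · have hx2 : x ^ 2 < 1 / 2 := by
      have := sq_lt_sq.2 ((abs_lt.2 hx).trans_le (le_abs_self _))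
      rwa [div_pow, Real.sq_sqrt (by norm_num), one_pow] at this
    have hp : 0 < √(1 - x ^ 2) := Real.sqrt_pos.2 (by linarith)
    have hsq : √(1 - x ^ 2) ^ 2 = 1 - x ^ 2 := Real.sq_sqrt (by linarith)
    have hlt : |x / √(1 - x ^ 2)| < 1 := by
      refine abs_lt_of_sq_lt_sq ?_ (by norm_num)
      rw [div_pow, hsq, one_pow, div_lt_one (by linarith)]
      linarith
    obtain ⟨h1, h2⟩ := abs_lt.1 hlt
    have hc : Real.cos (Real.arccos (x / √(1 - x ^ 2))) = x / √(1 - x ^ 2) :=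
      Real.cos_arccos h1.le h2.le
    -- Solving `x = cos k / √(1 + cos² k)` for `cos k` gives `x / √(1 - x²)`.
    refine ⟨Real.arccos (x / √(1 - x ^ 2)), ⟨Real.arccos_pos.2 h2, ?_⟩, ?_⟩
    · refine lt_of_le_of_ne (Real.arccos_le_pi _) fun h => ?_
      exact h1.not_ge (Real.arccos_eq_pi.1 h)
    · rw [groupVelocity, invRadius, hc, div_pow, hsq]
      have : 1 + x ^ 2 / (1 - x ^ 2) = (√(1 - x ^ 2) ^ 2)⁻¹ := by
        rw [hsq]
        have : 1 - x ^ 2 ≠ 0 := by linarith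
        field_simp
        ring
      rw [this, Real.sqrt_inv, Real.sqrt_sq hp.le, inv_inv, div_mul_cancel₀ _ hp.ne']

section

variable {E : Type*} [NormedAddCommGroup E] [NormedSpace ℝ E]

theorem indicator_fK_smul (g : ℝ → E) :
    (fun x => fK x • g x) =
      (Set.Ioo (-(1 / √2)) (1 / √2)).indicator fun x => fK x • g x := by
  ext x
  by_cases hx : x ∈ Set.Ioo (-(1 / √2)) (1 / √2)
  · rw [Set.indicator_of_mem hx]
  · rw [Set.indicator_of_notMem hx, fK, Set.indicator_of_notMem hx, zero_smul]

theorem abs_deriv_smul_fK_smul (g : ℝ → E) {k : ℝ} (hk : k ∈ Set.Ioo 0 Real.pi) :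
    |-(Real.sin k * invRadius k ^ 3)| • fK (groupVelocity k) • g (groupVelocity k) =
      Real.pi⁻¹ • g (groupVelocity k) := by
  have hs := Real.sin_pos_of_pos_of_lt_pi hk.1 hk.2
  have hr := invRadius_pos k
  rw [abs_neg, abs_of_pos (by positivity), smul_smul, (fK_groupVelocity hk).2]

theorem integral_fK_smul (g : ℝ → E) :
    ∫ x, fK x • g x = Real.pi⁻¹ • ∫ k in (0 : ℝ)..Real.pi, g (groupVelocity k) := by
  rw [indicator_fK_smul, integral_indicator measurableSet_Ioo, ← image_groupVelocity,
    integral_image_eq_integral_abs_deriv_smul measurableSet_Ioo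
      (fun k _ => (hasDerivAt_groupVelocity k).hasDerivWithinAt) injOn_groupVelocity,
    setIntegral_congr_fun measurableSet_Ioo (fun k hk => abs_deriv_smul_fK_smul g hk),
    integral_smul, intervalIntegral.integral_of_le Real.pi_pos.le, integral_Ioc_eq_integral_Ioo]

/-- The endpoint singularities of the density disappear under the substitution, which leaves a
continuous integrand on a compact interval; hence `g` needs no bound. -/
theorem integrable_fK_smul {g : ℝ → E} (hg : Continuous g) : Integrable fun x => fK x • g x := by
  rw [indicator_fK_smul, integrable_indicator_iff measurableSet_Ioo, ← image_groupVelocity,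
    integrableOn_image_iff_integrableOn_abs_deriv_smul measurableSet_Ioo
      (fun k _ => (hasDerivAt_groupVelocity k).hasDerivWithinAt) injOn_groupVelocity,
    integrableOn_congr_fun (fun k hk => abs_deriv_smul_fK_smul g hk) measurableSet_Ioo]
  refine IntegrableOn.mono_set ?_ Set.Ioo_subset_Icc_self
  exact ((hg.comp continuous_groupVelocity).const_smul _).continuousOn.integrableOn_Icc

end

/-! ### The limit law and its characteristic function -/

theorem fK_nonneg (x : ℝ) : 0 ≤ fK x := by
  refine Set.indicator_nonneg (fun x hx => ?_) x
  have hx2 : x ^ 2 < 1 / 2 := by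
    have := sq_lt_sq.2 ((abs_lt.2 hx).trans_le (le_abs_self _))
    rwa [div_pow, Real.sq_sqrt (by norm_num), one_pow] at this
  have : 0 ≤ 1 - x ^ 2 := by linarith
  have := Real.pi_pos
  positivity

theorem density_nonneg {c : ℝ} (hc : |c| ≤ 1) (x : ℝ) : 0 ≤ (1 - c * x) * fK x := by
  by_cases hx : x ∈ Set.Ioo (-(1 / √2)) (1 / √2)
  · refine mul_nonneg ?_ (fK_nonneg x)
    have h1 : |x| ≤ 1 := (abs_lt.2 hx).le.trans <| by
      rw [div_le_one (by positivity)]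
      exact Real.one_le_sqrt.2 (by norm_num)
    have : |c * x| ≤ 1 := by
      rw [abs_mul]; exact mul_le_one₀ hc (abs_nonneg _) h1
    linarith [le_abs_self (c * x)]
  · rw [fK, Set.indicator_of_notMem hx, mul_zero]

theorem integrable_density (c : ℝ) : Integrable fun x => (1 - c * x) * fK x := by
  have := integrable_fK_smul (g := fun x : ℝ => 1 - c * x) (by fun_prop)
  simpa only [smul_eq_mul, mul_comm] using this

theorem integral_density (c : ℝ) : ∫ x, (1 - c * x) * fK x = 1 := by
  -- The velocity is odd about `π / 2`, so the linear term contributes no mass.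
  have h0 : ∫ k in (0 : ℝ)..Real.pi, groupVelocity k = 0 := by
    have := intervalIntegral.integral_comp_sub_left (a := 0) (b := Real.pi) groupVelocity Real.pi
    simp only [groupVelocity_pi_sub, intervalIntegral.integral_neg, sub_self, sub_zero] at this
    linarith
  have h := integral_fK_smul fun x : ℝ => 1 - c * x
  simp only [smul_eq_mul] at h
  simp only [mul_comm _ (fK _), h]
  rw [intervalIntegral.integral_sub (by simp)
    (Continuous.intervalIntegrable (by fun_prop) _ _),
    intervalIntegral.integral_const_mul, h0]
  simp [Real.pi_ne_zero]

/-- The limit law, with density `(1 - c x) f_K(x)`. -/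
def limitLaw (c : ℝ) : Measure ℝ := volume.withDensity fun x => ENNReal.ofReal ((1 - c * x) * fK x)

theorem isProbabilityMeasure_limitLaw {c : ℝ} (hc : |c| ≤ 1) :
    IsProbabilityMeasure (limitLaw c) := by
  constructor
  rw [limitLaw, withDensity_apply _ MeasurableSet.univ, Measure.restrict_univ,
    ← ofReal_integral_eq_lintegral_ofReal (integrable_density c)
      (ae_of_all _ (density_nonneg hc)), integral_density, ENNReal.ofReal_one]

theorem integral_limitLaw {E : Type*} [NormedAddCommGroup E] [NormedSpace ℝ E] {c : ℝ}
    (hc : |c| ≤ 1) (g : ℝ → E) :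
    ∫ x, g x ∂(limitLaw c) = ∫ x, ((1 - c * x) * fK x) • g x := by
  rw [limitLaw, integral_withDensity_eq_integral_toReal_smul₀
    (integrable_density c).aestronglyMeasurable.aemeasurable.ennreal_ofReal (by simp)]
  simp [ENNReal.toReal_ofReal (density_nonneg hc _)]

/-- This form displays the affine dependence on `c`, which is what lets the average over
environments pass to the parameter. -/
theorem charFun_limitLaw {c : ℝ} (hc : |c| ≤ 1) (ξ : ℝ) :
    charFun (limitLaw c) ξ =
      (∫ x : ℝ, fK x • Complex.exp (ξ * x * Complex.I)) -
        c * ∫ x : ℝ, fK x • (x * Complex.exp (ξ * x * Complex.I)) := by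
  rw [charFun_apply_real, integral_limitLaw hc, ← integral_const_mul, ← integral_sub]
  · congr 1 with x
    simp only [Complex.real_smul]
    push_cast
    ring
  · exact integrable_fK_smul (by fun_prop)
  · exact (integrable_fK_smul (by fun_prop)).const_mul _

theorem integral_limitIntegrand_eq (ξ t : ℝ) :
    (2 * Real.pi : ℂ)⁻¹ * ∫ k in (-Real.pi)..Real.pi, limitIntegrand ξ t k =
      (∫ x : ℝ, fK x • Complex.exp (ξ * x * Complex.I)) -
        Real.sin t * ∫ x : ℝ, fK x • (x * Complex.exp (ξ * x * Complex.I)) := by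
  have h := integral_fK_smul fun x : ℝ =>
    Complex.exp (ξ * x * Complex.I) * (1 - Real.sin t * x)
  rw [integral_limitIntegrand, ← h, ← charFun_limitLaw (Real.abs_sin_le_one t), charFun_apply_real,
    integral_limitLaw (Real.abs_sin_le_one t)]
  congr 1 with x
  simp only [Complex.real_smul]
  push_cast
  ring

/-! ### Averaging over environments and weak convergence -/

theorem integral_quenched (n : ℕ) (ω : Env) (g : ℤ → ℂ) :
    ∫ z, g z ∂(quenched n ω) = ∑ p ∈ Finset.HasAntidiagonal.antidiagonal n,
      (prob ω n p.1 p.2 : ℂ) * g (p.2 - p.1) := by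
  change ∫ z, g z ∂(∑ p ∈ Finset.HasAntidiagonal.antidiagonal n,
    ENNReal.ofReal (prob ω n p.1 p.2) • Measure.dirac ((p.2 : ℤ) - (p.1 : ℤ))) = _
  rw [integral_finsetSum_measure fun p _ =>
    (integrable_dirac (by finiteness)).smul_measure ENNReal.ofReal_ne_top]
  refine Finset.sum_congr rfl fun p _ => ?_
  rw [integral_smul_measure, integral_dirac, ENNReal.toReal_ofReal (by unfold prob; positivity),
    Complex.real_smul]

/-- The law of `X_n / n` under the annealed measure. -/
def scaledLaw (μ : ℤ → Measure ℝ) [∀ x, IsProbabilityMeasure (μ x)] (n : ℕ) : Measure ℝ :=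
  (annealed μ n).map fun p => (p.2 : ℝ) / n

section

variable (μ : ℤ → Measure ℝ) [∀ x, IsProbabilityMeasure (μ x)]

theorem measurable_scaledPosition (n : ℕ) : Measurable fun p : Env × ℤ => (p.2 : ℝ) / n :=
  (measurable_of_countable fun z : ℤ => (z : ℝ) / n).comp measurable_snd

instance (n : ℕ) : IsProbabilityMeasure (annealed μ n) := by
  unfold annealed; infer_instance

instance (n : ℕ) : IsProbabilityMeasure (scaledLaw μ n) :=
  Measure.isProbabilityMeasure_map (measurable_scaledPosition n).aemeasurable

theorem charFun_scaledLaw (n : ℕ) (ξ : ℝ) :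
    charFun (scaledLaw μ n) ξ = ∫ ω, ∑ p ∈ Finset.HasAntidiagonal.antidiagonal n,
      Complex.exp (Complex.I * (ξ / n : ℝ) * ((p.2 - p.1 : ℤ) : ℂ)) * (prob ω n p.1 p.2 : ℂ)
      ∂(envLaw μ) := by
  have hm := measurable_scaledPosition n
  rw [charFun_apply_real, scaledLaw, integral_map hm.aemeasurable (by fun_prop), annealed,
    Measure.integral_compProd]
  · refine integral_congr_ae (ae_of_all _ fun ω => ?_)
    simp only
    rw [integral_quenched n ω fun z : ℤ => Complex.exp (ξ * ((z / n : ℝ) : ℂ) * Complex.I)]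
    refine Finset.sum_congr rfl fun p _ => ?_
    rw [mul_comm]
    congr 2
    push_cast
    ring
  · refine Integrable.of_bound (Measurable.aestronglyMeasurable (by fun_prop)) 1
      (ae_of_all _ fun p => ?_)
    rw [← Complex.ofReal_mul, Complex.norm_exp_ofReal_mul_I]

theorem integrable_sin_env (x : ℤ) : Integrable (fun ω => Real.sin (ω x)) (envLaw μ) :=
  Integrable.of_bound (Measurable.aestronglyMeasurable (by fun_prop)) 1
    (ae_of_all _ fun ω => Real.abs_sin_le_one _)

theorem abs_integral_sin_env_le_one (x : ℤ) : |∫ ω, Real.sin (ω x) ∂(envLaw μ)| ≤ 1 := by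
  have := norm_integral_le_of_norm_le_const (μ := envLaw μ) (f := fun ω => Real.sin (ω x)) (C := 1)
    (ae_of_all _ fun ω => Real.abs_sin_le_one (ω x))
  simpa using this

theorem tendsto_charFun_scaledLaw (ξ : ℝ) :
    Tendsto (fun n => charFun (scaledLaw μ n) ξ) atTop
      (𝓝 (charFun (limitLaw (∫ ω, Real.sin (ω 0) ∂(envLaw μ))) ξ)) := by
  -- The quenched limit is affine in `sin (ω 0)`, so its mean is the same expression at the mean of
  -- `sin (ω 0)`.
  have hlim : charFun (limitLaw (∫ ω, Real.sin (ω 0) ∂(envLaw μ))) ξ =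
      ∫ ω, ((2 * Real.pi : ℂ)⁻¹ *
        ∫ k in (-Real.pi)..Real.pi, limitIntegrand ξ (ω 0) k) ∂(envLaw μ) := by
    simp only [integral_limitIntegrand_eq, charFun_limitLaw (abs_integral_sin_env_le_one μ 0)]
    rw [integral_sub (integrable_const _) ((integrable_sin_env μ 0).ofReal.mul_const _),
      integral_mul_const, integral_const, integral_complex_ofReal]
    simp
  rw [hlim]
  simp only [charFun_scaledLaw]
  refine tendsto_integral_of_dominated_convergence (fun _ => 1) (fun n => ?_)
    (integrable_const _) (fun n => ae_of_all _ fun ω => ?_)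
    (ae_of_all _ fun ω => tendsto_sum_exp_mul_prob ω ξ)
  · refine Measurable.aestronglyMeasurable (Finset.measurable_fun_sum _ fun p _ => ?_)
    exact (Complex.measurable_ofReal.comp (measurable_prob n p.1 p.2)).const_mul _
  -- The dominating constant 1 is the total mass, each exponential being unimodular.
  · rw [← sum_prob ω n]
    refine norm_sum_le_of_le _ fun p _ => ?_
    rw [norm_mul, show Complex.I * ((ξ / n : ℝ) : ℂ) * ((p.2 - p.1 : ℤ) : ℂ) =
      ((ξ / n * ((p.2 - p.1 : ℤ) : ℝ) : ℝ) : ℂ) * Complex.I by push_cast; ring,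
      Complex.norm_exp_ofReal_mul_I, one_mul, Complex.norm_real, Real.norm_of_nonneg]
    unfold prob; positivity

theorem tendsto_integral_boundedContinuous (g : ℝ →ᵇ ℝ) :
    Tendsto (fun n : ℕ => ∫ p, g ((p.2 : ℝ) / n) ∂(annealed μ n)) atTop
      (𝓝 (∫ x : ℝ, g x * ((1 - (∫ ω, Real.sin (ω 0) ∂(envLaw μ)) * x) * fK x))) := by
  have hc := abs_integral_sin_env_le_one μ 0
  have := isProbabilityMeasure_limitLaw hc
  have h := ProbabilityMeasure.tendsto_of_tendsto_charFun
    (μ := fun n => (⟨scaledLaw μ n, inferInstance⟩ : ProbabilityMeasure ℝ))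
    (μ₀ := ⟨limitLaw _, this⟩) (tendsto_charFun_scaledLaw μ)
  have hg := ProbabilityMeasure.tendsto_iff_forall_integral_tendsto.1 h g
  simp only [ProbabilityMeasure.coe_mk, integral_limitLaw hc, smul_eq_mul] at hg
  simp only [mul_comm (g _)]
  refine hg.congr fun n => ?_
  rw [scaledLaw, integral_map (measurable_scaledPosition n).aemeasurable
    g.continuous.aestronglyMeasurable]

theorem tendsto_annealed_Icc {u v : ℝ} (huv : u ≤ v) :
    Tendsto (fun n : ℕ => (annealed μ n).real {p | u ≤ (p.2 : ℝ) / n ∧ (p.2 : ℝ) / n ≤ v}) atTop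
      (𝓝 (∫ x in u..v, (1 - (∫ ω, Real.sin (ω 0) ∂(envLaw μ)) * x) * fK x)) := by
  have hc := abs_integral_sin_env_le_one μ 0
  have := isProbabilityMeasure_limitLaw hc
  have h := ProbabilityMeasure.tendsto_of_tendsto_charFun
    (μ := fun n => (⟨scaledLaw μ n, inferInstance⟩ : ProbabilityMeasure ℝ))
    (μ₀ := ⟨limitLaw _, this⟩) (tendsto_charFun_scaledLaw μ)
  -- The limit law is absolutely continuous, so the end points carry no mass and the portmanteau
  -- theorem applies to the closed interval.
  have hfr : limitLaw (∫ ω, Real.sin (ω 0) ∂(envLaw μ)) (frontier (Set.Icc u v)) = 0 := by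
    refine withDensity_absolutelyContinuous _ _ ?_
    rw [frontier_Icc huv]
    exact (Set.toFinite _).measure_zero _
  have hI := ProbabilityMeasure.tendsto_measure_of_null_frontier_of_tendsto' h hfr
  simp only [ProbabilityMeasure.coe_mk] at hI
  have hval : (limitLaw (∫ ω, Real.sin (ω 0) ∂(envLaw μ)) (Set.Icc u v)).toReal =
      ∫ x in u..v, (1 - (∫ ω, Real.sin (ω 0) ∂(envLaw μ)) * x) * fK x := by
    rw [limitLaw, withDensity_apply _ measurableSet_Icc,
      ← ofReal_integral_eq_lintegral_ofReal (integrable_density _).integrableOn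
        (ae_of_all _ (density_nonneg hc)),
      ENNReal.toReal_ofReal (integral_nonneg (density_nonneg hc)),
      intervalIntegral.integral_of_le huv, integral_Icc_eq_integral_Ioc]
  rw [← hval]
  refine ((ENNReal.tendsto_toReal (measure_ne_top _ _)).comp hI).congr fun n => ?_
  rw [Function.comp, scaledLaw, Measure.map_apply (measurable_scaledPosition n) measurableSet_Icc]
  rfl

theorem integral_sin_env_eq_zero (x : ℤ) (h : (μ x).map (fun t : ℝ => -t) = μ x) :
    ∫ ω, Real.sin (ω x) ∂(envLaw μ) = 0 := by
  have h1 : ∫ ω, Real.sin (ω x) ∂(envLaw μ) = ∫ t, Real.sin t ∂(μ x) := by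
    rw [envLaw, ← Measure.infinitePi_map_eval μ x,
      integral_map (measurable_pi_apply x).aemeasurable (by fun_prop)]
  have h2 : ∫ t, Real.sin t ∂(μ x) = -∫ t, Real.sin t ∂(μ x) := by
    conv_lhs => rw [← h]
    rw [integral_map (by fun_prop) (by fun_prop), ← integral_neg]
    simp only [Real.sin_neg]
  linarith

end

end

end QWRE

theorem corollaryA (μ : ℤ → Measure ℝ) [∀ x, IsProbabilityMeasure (μ x)] :
    -- the limit function is a probability density
    ((∀ x : ℝ, 0 ≤ (1 - (∫ ω, Real.sin (ω 0) ∂(QWRE.envLaw μ)) * x) * QWRE.fK x) ∧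
      Integrable (fun x : ℝ => (1 - (∫ ω, Real.sin (ω 0) ∂(QWRE.envLaw μ)) * x) * QWRE.fK x) ∧
      ∫ x : ℝ, (1 - (∫ ω, Real.sin (ω 0) ∂(QWRE.envLaw μ)) * x) * QWRE.fK x = 1) ∧
    -- limits of the probabilities of intervals
    (∀ u v : ℝ, u ≤ v →
      Tendsto
        (fun n : ℕ => (QWRE.annealed μ n).real {p | u ≤ (p.2 : ℝ) / n ∧ (p.2 : ℝ) / n ≤ v})
        atTop
        (𝓝 (∫ x in u..v, (1 - (∫ ω, Real.sin (ω 0) ∂(QWRE.envLaw μ)) * x) * QWRE.fK x))) ∧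
    -- weak convergence
    (∀ g : ℝ →ᵇ ℝ,
      Tendsto (fun n : ℕ => ∫ p, g ((p.2 : ℝ) / n) ∂(QWRE.annealed μ n)) atTop
        (𝓝 (∫ x : ℝ, g x *
          ((1 - (∫ ω, Real.sin (ω 0) ∂(QWRE.envLaw μ)) * x) * QWRE.fK x)))) ∧
    -- the case of a symmetric law at the origin
    ((μ 0).map (fun t : ℝ => -t) = μ 0 →
      (∀ u v : ℝ, u ≤ v →
        Tendsto
          (fun n : ℕ => (QWRE.annealed μ n).real {p | u ≤ (p.2 : ℝ) / n ∧ (p.2 : ℝ) / n ≤ v})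
          atTop (𝓝 (∫ x in u..v, QWRE.fK x))) ∧
      (∀ g : ℝ →ᵇ ℝ,
        Tendsto (fun n : ℕ => ∫ p, g ((p.2 : ℝ) / n) ∂(QWRE.annealed μ n)) atTop
          (𝓝 (∫ x : ℝ, g x * QWRE.fK x)))) := by
  refine ⟨⟨QWRE.density_nonneg (QWRE.abs_integral_sin_env_le_one μ 0), QWRE.integrable_density _,
    QWRE.integral_density _⟩, fun u v huv => QWRE.tendsto_annealed_Icc μ huv,
    QWRE.tendsto_integral_boundedContinuous μ, fun hsymm => ?_⟩
  have h0 := QWRE.integral_sin_env_eq_zero μ 0 hsymm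
  refine ⟨fun u v huv => ?_, fun g => ?_⟩
  · simpa only [h0, zero_mul, sub_zero, one_mul] using QWRE.tendsto_annealed_Icc μ huv
  · simpa only [h0, zero_mul, sub_zero, one_mul] using QWRE.tendsto_integral_boundedContinuous μ g
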